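/- Let $E$ and $F$ be finite sets. A \emph{bimatroid} $\mathsf{A}$ on the ground set $E\times F$ is given by a set $\mathcal{R}(\mathsf{A})$ of pairs $(I,J)$ with $I\subseteq E$, $J\subseteq F$ and $|I|=|J|$, called the \emph{regular minors} of $\mathsf{A}$, such that $(\emptyset,\emptyset)\in\mathcal{R}(\mathsf{A})$ and, for all $(I,J),(I',J')\in\mathcal{R}(\mathsf{A})$: (a) for every $i'\in I'\setminus I$ there is $i\in I\setminus I'$ with $((I\setminus\{i\})\cup\{i'\},J)\in\mathcal{R}(\mathsf{A})$, or there is $j'\in J'\setminus J$ with $(I\cup\{i'\},J\cup\{j'\})\in\mathcal{R}(\mathsf{A})$; (b) for every $j\in J\setminus J'$ there is $j'\in J'\setminus J$ with $(I,(J\setminus\{j\})\cup\{j'\})\in\mathcal{R}(\mathsf{A})$, or there is $i\in I\setminus I'$ with $(I\setminus\{i\},J\setminus\{j\})\in\mathcal{R}(\mathsf{A})$. A finite sequence $a_0,\dots,a_s$ of non-negative real numbers is called \emph{ultra log-concave} if it has no internal zeros (if $i<k<j$, $a_i\neq 0$ and $a_j\neq0$, then $a_k\neq 0$) and the numbers $\widetilde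 a_k=a_k/\binom{s}{k}$ satisfy $\widetilde a_k^{\,2}\geq \widetilde a_{k-1}\widetilde a_{k+1}$ for all $0<k<s$. \textbf{Theorem.} Let $\mathsf{A}$ be a bimatroid on $E\times F$, let $m=|E|$, $n=|F|$ and $m\wedge n=\min\{m,n\}$, and for $k\geq 0$ let $R_k(\mathsf{A})$ be the number of regular minors $(I,J)$ of $\mathsf{A}$ with $|I|=|J|=k$. Then the sequence $R_0(\mathsf{A}),\dots,R_{m\wedge n}(\mathsf{A})$ is ultra log-concave. In particular, $$\frac{R_k(\mathsf{A})^2}{\binom{m\wedge n}{k}^2}\;\geq\;\frac{R_{k+1}(\mathsf{A})}{\binom{m\wedge n}{k+1}}\cdot\frac{R_{k-1}(\mathsf{A})}{\binom{m\wedge n}{k-1}}\qquad\text{for all } k\geq 1,$$ where for $l>m\wedge n$ (when $R_l(\mathsf{A})=0$ and $\binom{m\wedge n}{l}=0$) the quotient $R_l(\mathsf{A})/\binom{m\wedge n}{l}$ is read as $0$. -/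

import Mathlib

/-- A bimatroid on the ground set `E × F`, given by its set of regular minors. A minor is a pair
`(I, J)` of subsets `I ⊆ E`, `J ⊆ F` of the same size. -/
@[ext]
structure Bimatroid (E F : Type*) [DecidableEq E] [DecidableEq F] where
  /-- The set of regular minors. -/
  regularMinors : Set (Finset E × Finset F)
  /-- Regular minors are square. -/
  card_eq : ∀ I J, (I, J) ∈ regularMinors → I.card = J.card
  /-- The empty minor is regular. -/
  empty_mem : ((∅ : Finset E), (∅ : Finset F)) ∈ regularMinors
  /-- Row exchange. -/
  exchange_row : ∀ I J I' J', (I, J) ∈ regularMinors → (I', J') ∈ regularMinors →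
    ∀ i' ∈ I' \ I,
      (∃ i ∈ I \ I', (insert i' (I.erase i), J) ∈ regularMinors) ∨
      (∃ j' ∈ J' \ J, (insert i' I, insert j' J) ∈ regularMinors)
  /-- Column exchange. -/
  exchange_col : ∀ I J I' J', (I, J) ∈ regularMinors → (I', J') ∈ regularMinors →
    ∀ j ∈ J \ J',
      (∃ j' ∈ J' \ J, (I, insert j' (J.erase j)) ∈ regularMinors) ∨
      (∃ i ∈ I \ I', (I.erase i, J.erase j) ∈ regularMinors)

/-- The number `R_k(A)` of regular `k × k` minors of the bimatroid `A`. -/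
noncomputable def Bimatroid.numRegularMinors {E F : Type*} [DecidableEq E] [DecidableEq F]
    (A : Bimatroid E F) (k : ℕ) : ℕ :=
  {p : Finset E × Finset F | p ∈ A.regularMinors ∧ p.1.card = k}.ncard

/-- The finite sequence `a 0, …, a s` of real numbers is non-negative, has no internal zeros and is
log-concave. (Values `a k` with `k > s` are irrelevant.) -/
def IsLogConcaveSeq (s : ℕ) (a : ℕ → ℝ) : Prop :=
  (∀ k ≤ s, 0 ≤ a k) ∧
  (∀ i j k, i < k → k < j → j ≤ s → a i ≠ 0 → a j ≠ 0 → a k ≠ 0) ∧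
  (∀ k, 1 ≤ k → k < s → a (k + 1) * a (k - 1) ≤ a k ^ 2)

/-- The finite sequence `a 0, …, a s` is ultra log-concave: the sequence `a k / (s choose k)`,
for `0 ≤ k ≤ s`, is log-concave. -/
def IsUltraLogConcaveSeq (s : ℕ) (a : ℕ → ℝ) : Prop :=
  IsLogConcaveSeq s (fun k => a k / (s.choose k : ℝ))

/-! The sets `(E \ I) ∪ J`, for `(I, J)` regular, are the bases of a matroid of rank `m` on `E ⊕ F`.
Such a base meets `F` in `J`, so `R_k` counts bases meeting `F` in `k` elements. The dual has rank
`n`, and its bases `I ∪ (F \ J)` meet `E` in `I`. Hence it suffices that, in a matroid of rank `r`,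
the counts of bases by intersection size with a fixed set are ultra log-concave of order `r`; the
matroid or its dual is used according to which of `m`, `n` is smaller.

Differentiating the basis generating polynomial `a` times along the indicator of the complement and
`b` times along that of the set gives `a! b!` times a base count. Dividing by `r!` produces exactly
the binomial normalization, so the claim is the reverse Cauchy-Schwarz inequality for mixed
derivatives (`mixedSum_mul_le_sq`).

That inequality is proved by induction on the degree. In degree two the form is a square minus a sum
of squares over parallel classes. In higher degree, the inequality in the links (contractions by one
element) gives a Bochner-type bound on the second-derivative matrix `C`; as the graph of `C` is
connected, inverting its Laplacian makes the form nonpositive on a hyperplane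
(`form_nonpos_of_bochner`). -/

section

open Finset

/-! ### Graph Laplacians and the Bochner argument -/

/-- A symmetric matrix `C` with row sums `c` acts by `Cz = cz - Ly`, where `L` is the Laplacian. The
Laplacian energy is half the sum of the squared differences. -/
theorem laplacian_energy_nonneg {ι : Type*} [Fintype ι] (C : ι → ι → ℝ)
    (hsymm : ∀ i j, C i j = C j i) (hC : ∀ i j, 0 ≤ C i j) (z : ι → ℝ) :
    2 * ∑ i, z i * ((∑ j, C i j) * z i - ∑ j, C i j * z j) =
      ∑ i, ∑ j, C i j * (z i - z j) ^ 2 ∧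
    0 ≤ ∑ i, ∑ j, C i j * (z i - z j) ^ 2 := by
  refine ⟨?_, sum_nonneg fun i _ => sum_nonneg fun j _ => mul_nonneg (hC i j) (sq_nonneg _)⟩
  have h1 : ∑ i, ∑ j, C i j * z j ^ 2 = ∑ i, ∑ j, C i j * z i ^ 2 := by
    rw [sum_comm]
    exact sum_congr rfl fun i _ => sum_congr rfl fun j _ => by rw [hsymm]
  have h2 : ∑ i, ∑ j, C i j * (z i - z j) ^ 2 =
      ∑ i, ∑ j, C i j * z i ^ 2 + ∑ i, ∑ j, C i j * z j ^ 2
        - 2 * ∑ i, ∑ j, z i * (C i j * z j) := by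
    rw [mul_sum, ← sum_add_distrib, ← sum_sub_distrib]
    refine sum_congr rfl fun i _ => ?_
    rw [mul_sum, ← sum_add_distrib, ← sum_sub_distrib]
    exact sum_congr rfl fun j _ => by ring
  have h3 : ∑ i, z i * ((∑ j, C i j) * z i - ∑ j, C i j * z j) =
      ∑ i, ∑ j, C i j * z i ^ 2 - ∑ i, ∑ j, z i * (C i j * z j) := by
    rw [← sum_sub_distrib]
    refine sum_congr rfl fun i _ => ?_
    rw [mul_sub, mul_sum, sum_mul, mul_sum]
    congr 1
    exact sum_congr rfl fun j _ => by ring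
  rw [h2, h1, h3]
  ring

/-- The Laplacian of a connected nonnegative symmetric matrix surjects onto the vectors supported
off the zero rows with vanishing coordinate sum. -/
theorem exists_laplacian_eq {ι : Type*} [Fintype ι] (C : ι → ι → ℝ)
    (hsymm : ∀ i j, C i j = C j i) (hC : ∀ i j, 0 ≤ C i j) (c : ι → ℝ) (hc : ∀ i, c i = ∑ j, C i j)
    (hconn : ∀ z : ι → ℝ, (∀ i j, C i j ≠ 0 → z i = z j) → ∀ i j, c i ≠ 0 → c j ≠ 0 → z i = z j)
    (z : ι → ℝ) (hz : ∑ i, c i * z i = 0) :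
    ∃ y : ι → ℝ, ∀ i, c i * y i - ∑ j, C i j * y j = c i * z i := by
  classical
  have hc0 : ∀ i, 0 ≤ c i := fun i => by rw [hc]; exact sum_nonneg fun j _ => hC i j
  have hrow : ∀ i, c i = 0 → ∀ j, C i j = 0 := fun i hi j => by
    rw [hc, sum_eq_zero_iff_of_nonneg fun j _ => hC i j] at hi
    exact hi j (mem_univ j)
  have hLsum : ∀ y : ι → ℝ, ∑ i, (c i * y i - ∑ j, C i j * y j) = 0 := fun y => by
    rw [sum_sub_distrib, sum_comm, sub_eq_zero]
    refine sum_congr rfl fun i _ => ?_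
    rw [← sum_mul, hc]
    simp_rw [hsymm i]
  -- The Laplacian with its kernel removed: the rank-one term detects constants on the support of
  -- `c`, the last term handles the zero rows. Both corrections vanish on solutions whose right-hand
  -- side sums to zero.
  let L : (ι → ℝ) →ₗ[ℝ] (ι → ℝ) :=
    { toFun := fun y i => c i * y i - ∑ j, C i j * y j + c i * ∑ j, c j * y j
        + if c i = 0 then y i else 0
      map_add' := fun x y => by
        funext i
        simp only [Pi.add_apply, mul_add, sum_add_distrib]
        split_ifs <;> ring
      map_smul' := fun t y => by
        funext i
        have h1 : ∑ j, C i j * (t * y j) = t * ∑ j, C i j * y j := by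
          rw [mul_sum]; exact sum_congr rfl fun j _ => by ring
        have h2 : ∑ j, c j * (t * y j) = t * ∑ j, c j * y j := by
          rw [mul_sum]; exact sum_congr rfl fun j _ => by ring
        simp only [Pi.smul_apply, smul_eq_mul, RingHom.id_apply, h1, h2]
        split_ifs <;> ring }
  have key : ∀ y x : ι → ℝ, ∑ i, c i * x i = 0 → L y = (fun i => c i * x i) →
      (∀ i, c i = 0 → y i = 0) ∧ ∑ j, c j * y j = 0 ∧
        ∀ i, c i * y i - ∑ j, C i j * y j = c i * x i := by
    intro y x hx h
    have hi : ∀ i, c i * y i - ∑ j, C i j * y j + c i * ∑ j, c j * y j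
        + (if c i = 0 then y i else 0) = c i * x i := fun i => congrFun h i
    have hy0 : ∀ i, c i = 0 → y i = 0 := fun i h0 => by
      have := hi i
      simpa [h0, hrow i h0] using this
    have hi' : ∀ i, c i * y i - ∑ j, C i j * y j + c i * ∑ j, c j * y j = c i * x i := fun i => by
      have := hi i
      split_ifs at this with h0
      · rw [hy0 i h0, add_zero] at this
        rw [hy0 i h0]; exact this
      · simpa using this
    have hs : (∑ i, c i) * ∑ j, c j * y j = 0 := by
      have := sum_congr (s₁ := univ) rfl fun i _ => hi' i
      rw [sum_add_distrib, hLsum, ← sum_mul, hx, zero_add] at this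
      exact this
    have hsy : ∑ j, c j * y j = 0 := by
      rcases mul_eq_zero.1 hs with h | h
      · rw [sum_eq_zero_iff_of_nonneg fun i _ => hc0 i] at h
        exact sum_eq_zero fun i hi => by rw [h i hi, zero_mul]
      · exact h
    refine ⟨hy0, hsy, fun i => ?_⟩
    have := hi' i
    rwa [hsy, mul_zero, add_zero] at this
  have hinj : Function.Injective L := by
    rw [injective_iff_map_eq_zero]
    intro y hy
    obtain ⟨hy0, hsy, hLy⟩ := key y 0 (by simp) (by rw [hy]; funext i; simp)
    -- Zero energy makes `y` constant along edges, hence by connectivity on the support of `c`; its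
    -- weighted sum is zero, so the constant is zero.
    have hE := laplacian_energy_nonneg C hsymm hC y
    have hz0 : ∑ i, ∑ j, C i j * (y i - y j) ^ 2 = 0 := by
      rw [← hE.1]
      simp only [← hc, hLy]
      simp
    rw [sum_eq_zero_iff_of_nonneg fun i _ => sum_nonneg fun j _ =>
      mul_nonneg (hC i j) (sq_nonneg _)] at hz0
    have heq : ∀ i j, C i j ≠ 0 → y i = y j := fun i j hij => by
      have := hz0 i (mem_univ i)
      rw [sum_eq_zero_iff_of_nonneg fun j _ => mul_nonneg (hC i j) (sq_nonneg _)] at this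
      have := this j (mem_univ j)
      rcases mul_eq_zero.1 this with h | h
      · exact absurd h hij
      · exact sub_eq_zero.1 (pow_eq_zero_iff two_ne_zero |>.1 h)
    funext i
    by_cases h0 : c i = 0
    · exact hy0 i h0
    have h1 : ∑ j, c j * y j = (∑ j, c j) * y i := by
      rw [sum_mul]
      refine sum_congr rfl fun j _ => ?_
      by_cases hj : c j = 0
      · rw [hj, zero_mul, zero_mul]
      · rw [hconn y heq i j h0 hj]
    have hpos : 0 < ∑ j, c j :=
      sum_pos' (fun j _ => hc0 j) ⟨i, mem_univ i, lt_of_le_of_ne (hc0 i) (Ne.symm h0)⟩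
    rw [hsy] at h1
    exact (mul_eq_zero.1 h1.symm).resolve_left hpos.ne'
  obtain ⟨y, hy⟩ := LinearMap.injective_iff_surjective.1 hinj (fun i => c i * z i)
  exact ⟨y, (key y z hz hy).2.2⟩

/-- The Bochner argument: if the form of a connected nonnegative symmetric matrix `C` is bounded by
the weighted square norm of `Cz`, then it is nonpositive on the complement of the row-sum vector. -/
theorem form_nonpos_of_bochner {ι : Type*} [Fintype ι] (C : ι → ι → ℝ)
    (hsymm : ∀ i j, C i j = C j i) (hC : ∀ i j, 0 ≤ C i j) (c : ι → ℝ) (hc : ∀ i, c i = ∑ j, C i j)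
    (hconn : ∀ z : ι → ℝ, (∀ i j, C i j ≠ 0 → z i = z j) → ∀ i j, c i ≠ 0 → c j ≠ 0 → z i = z j)
    (hB : ∀ z : ι → ℝ, ∑ i, z i * ∑ j, C i j * z j ≤ ∑ i, (∑ j, C i j * z j) ^ 2 / c i)
    (z : ι → ℝ) (hz : ∑ i, c i * z i = 0) :
    ∑ i, z i * ∑ j, C i j * z j ≤ 0 := by
  obtain ⟨y, hy⟩ := exists_laplacian_eq C hsymm hC c hc hconn z hz
  have hrow : ∀ i, c i = 0 → ∀ j, C i j = 0 := fun i hi j => by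
    rw [hc, sum_eq_zero_iff_of_nonneg fun j _ => hC i j] at hi
    exact hi j (mem_univ j)
  have hCy : ∀ i, ∑ j, C i j * y j = c i * (y i - z i) := fun i => by linarith [hy i]
  -- The Bochner bound is applied to `y`, for which `Cy = c(y - z)`. Where `c i = 0` the quotient is
  -- `0`, consistent with the row being zero.
  have hBy : ∑ i, y i * (c i * z i) ≤ ∑ i, z i * (c i * z i) := by
    have h := hB y
    have h1 : ∀ i, (∑ j, C i j * y j) ^ 2 / c i = c i * (y i - z i) ^ 2 := fun i => by
      rw [hCy]
      by_cases h0 : c i = 0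
      · simp [h0]
      · field_simp
    rw [sum_congr rfl fun i _ => h1 i] at h
    simp only [hCy] at h
    have h2 : ∑ i, c i * (y i - z i) ^ 2 - ∑ i, y i * (c i * (y i - z i)) =
        ∑ i, z i * (c i * z i) - ∑ i, y i * (c i * z i) := by
      rw [← sum_sub_distrib, ← sum_sub_distrib]
      exact sum_congr rfl fun i _ => by ring
    linarith
  -- The Laplacian of `z - y` is `-Cz`, so half its energy is `-⟨z, Cz⟩ - ⟨z, cz⟩ + ⟨y, cz⟩`; this
  -- is nonnegative, and `hBy` bounds the last two terms by zero.
  have hE := laplacian_energy_nonneg C hsymm hC (fun i => z i - y i)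
  have hyCz : ∑ i, y i * ∑ j, C i j * z j = ∑ i, z i * ∑ j, C i j * y j := by
    simp only [mul_sum]
    rw [sum_comm]
    exact sum_congr rfl fun i _ => sum_congr rfl fun j _ => by rw [hsymm]; ring
  have hexp : ∑ i, (z i - y i) * (c i * (z i - y i) - ∑ j, C i j * (z j - y j)) =
      ∑ i, z i * (c i * z i) - ∑ i, z i * ∑ j, C i j * z j
        - ∑ i, z i * (c i * z i) - ∑ i, z i * (c i * z i) + ∑ i, y i * (c i * z i) := by
    have h1 : ∀ i, (z i - y i) * (c i * (z i - y i) - ∑ j, C i j * (z j - y j)) =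
        z i * (c i * z i) - z i * ∑ j, C i j * z j - z i * (c i * z i)
          - (y i * (c i * z i) - y i * ∑ j, C i j * z j) + y i * (c i * z i) := fun i => by
      have : ∑ j, C i j * (z j - y j) = ∑ j, C i j * z j - ∑ j, C i j * y j := by
        rw [← sum_sub_distrib]; exact sum_congr rfl fun j _ => by ring
      rw [this, hCy]; ring
    have h2 : ∑ i, (y i * (c i * z i) - y i * ∑ j, C i j * z j) = ∑ i, z i * (c i * z i) := by
      rw [sum_sub_distrib, hyCz, ← sum_sub_distrib]
      exact sum_congr rfl fun i _ => by rw [hCy]; ring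
    simp only [h1]
    rw [sum_add_distrib, sum_sub_distrib, h2, sum_sub_distrib, sum_sub_distrib]
  have h0 := hE.1
  simp only [← hc] at h0
  rw [hexp] at h0
  linarith [hE.2]

/-! ### Mixed derivatives of independent-set polynomials -/

namespace Matroid

variable {α : Type*} [DecidableEq α]

open Classical in
/-- The indicator (in `ℝ`) of the elements `i ∉ S` for which `insert i S` is independent. -/
noncomputable def extend (M : Matroid α) (S : Finset α) (i : α) : ℝ :=
  if i ∉ S ∧ M.Indep (insert i S : Finset α) then 1 else 0

variable (M : Matroid α)

theorem extend_nonneg (S : Finset α) (i : α) : 0 ≤ M.extend S i := by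
  unfold extend; split_ifs <;> norm_num

theorem extend_eq_one {S : Finset α} {i : α} (h : i ∉ S ∧ M.Indep (insert i S : Finset α)) :
    M.extend S i = 1 := if_pos h

theorem extend_ne_zero_iff {S : Finset α} {i : α} :
    M.extend S i ≠ 0 ↔ i ∉ S ∧ M.Indep (insert i S : Finset α) := by
  unfold extend
  split_ifs with h
  · exact ⟨fun _ => h, fun _ => one_ne_zero⟩
  · exact ⟨fun h' => absurd rfl h', fun h' => absurd h' h⟩

/-- Both sides indicate that `i`, `j` are distinct, outside `S`, and extend it jointly; this is the
symmetry of second derivatives. -/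
theorem extend_mul_extend_comm (S : Finset α) (i j : α) :
    M.extend S i * M.extend (insert i S) j = M.extend S j * M.extend (insert j S) i := by
  have key : ∀ i j, M.extend S i * M.extend (insert i S) j ≠ 0 →
      M.extend S i * M.extend (insert i S) j = M.extend S j * M.extend (insert j S) i := by
    intro i j h
    obtain ⟨h1, h2⟩ := ne_zero_and_ne_zero_of_mul h
    obtain ⟨hi, hi'⟩ := M.extend_ne_zero_iff.1 h1
    obtain ⟨hj, hj'⟩ := M.extend_ne_zero_iff.1 h2
    rw [mem_insert, not_or] at hj
    rw [extend_eq_one M ⟨hi, hi'⟩, extend_eq_one M ⟨by simp [hj], hj'⟩,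
      extend_eq_one M ⟨hj.2, hj'.subset (by
        simp only [coe_insert]; exact Set.insert_subset_insert (Set.subset_insert _ _))⟩,
      extend_eq_one M ⟨by simp [hi, Ne.symm hj.1], by rwa [Finset.insert_comm]⟩]
  by_cases h : M.extend S i * M.extend (insert i S) j = 0
  · by_cases h' : M.extend S j * M.extend (insert j S) i = 0
    · rw [h, h']
    · exact (key j i h').symm
  · exact key i j h

variable [Fintype α]

/-- The iterated directional derivative, along the vectors of the list, of the generating
polynomial of the independent sets containing `S` (divided by the monomial of `S`) of size
`#S` plus the length of the list. -/
noncomputable def mixedSum : Finset α → List (α → ℝ) → ℝ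
  | _, [] => 1
  | S, v :: L => ∑ i, v i * (M.extend S i * mixedSum (insert i S) L)

theorem mixedSum_nil (S : Finset α) : M.mixedSum S [] = 1 := rfl

theorem mixedSum_cons (S : Finset α) (v : α → ℝ) (L : List (α → ℝ)) :
    M.mixedSum S (v :: L) = ∑ i, v i * (M.extend S i * M.mixedSum (insert i S) L) := rfl

theorem mixedSum_sub_smul (S : Finset α) (x y : α → ℝ) (t : ℝ) (L : List (α → ℝ)) :
    M.mixedSum S ((x - t • y) :: L) = M.mixedSum S (x :: L) - t * M.mixedSum S (y :: L) := by
  simp only [mixedSum_cons, mul_sum, ← sum_sub_distrib]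
  exact sum_congr rfl fun i _ => by simp only [Pi.sub_apply, Pi.smul_apply, smul_eq_mul]; ring

theorem mixedSum_cons_cons (S : Finset α) (x y : α → ℝ) (L : List (α → ℝ)) :
    M.mixedSum S (x :: y :: L) = ∑ i, x i * ∑ j, M.extend S i * M.extend (insert i S) j *
      M.mixedSum (insert j (insert i S)) L * y j := by
  rw [mixedSum_cons]
  refine sum_congr rfl fun i _ => ?_
  rw [mixedSum_cons, mul_sum]
  congr 1
  exact sum_congr rfl fun j _ => by ring

theorem mixedSum_swap (S : Finset α) (x y : α → ℝ) (L : List (α → ℝ)) :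
    M.mixedSum S (x :: y :: L) = M.mixedSum S (y :: x :: L) := by
  simp only [mixedSum_cons_cons, mul_sum]
  rw [sum_comm]
  refine sum_congr rfl fun i _ => sum_congr rfl fun j _ => ?_
  rw [extend_mul_extend_comm, Finset.insert_comm i j]
  ring

theorem mixedSum_perm {L L' : List (α → ℝ)} (h : L.Perm L') (S : Finset α) :
    M.mixedSum S L = M.mixedSum S L' := by
  induction h generalizing S with
  | nil => rfl
  | cons x _ ih => rw [mixedSum_cons, mixedSum_cons]; simp only [ih]
  | swap x y l => exact M.mixedSum_swap S y x l
  | trans _ _ ih1 ih2 => rw [ih1, ih2]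

theorem mixedSum_nonneg (L : List (α → ℝ)) (hL : ∀ v ∈ L, ∀ i, 0 ≤ v i) (S : Finset α) :
    0 ≤ M.mixedSum S L := by
  induction L generalizing S with
  | nil => rw [mixedSum_nil]; norm_num
  | cons v L ih =>
    rw [mixedSum_cons]
    exact sum_nonneg fun i _ => mul_nonneg (hL v (by simp) i) (mul_nonneg (M.extend_nonneg S i)
      (ih (fun w hw => hL w (by simp [hw])) _))

/-- Augmenting `S` from `T` one element at a time supplies a strictly positive term at every
derivative. -/
theorem mixedSum_pos (L : List (α → ℝ)) (hL : ∀ v ∈ L, ∀ i, 0 < v i) (S T : Finset α)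
    (hS : M.Indep S) (hT : M.Indep T) (hcard : #S + L.length ≤ #T) : 0 < M.mixedSum S L := by
  induction L generalizing S with
  | nil => rw [mixedSum_nil]; norm_num
  | cons v L ih =>
    rw [List.length_cons] at hcard
    obtain ⟨e, he, heS, hind⟩ := hS.augment_finset hT (by omega)
    rw [← coe_insert] at hind
    have hL' : ∀ w ∈ L, ∀ i, 0 < w i := fun w hw => hL w (by simp [hw])
    rw [mixedSum_cons]
    refine sum_pos' (fun i _ => mul_nonneg (hL v (by simp) i).le (mul_nonneg (M.extend_nonneg S i)
      (M.mixedSum_nonneg L (fun w hw i => (hL' w hw i).le) _))) ⟨e, mem_univ e, ?_⟩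
    rw [extend_eq_one M ⟨heS, hind⟩, one_mul]
    exact mul_pos (hL v (by simp) e)
      (ih hL' _ hind (by rw [card_insert_of_notMem heS]; omega))

theorem exists_indep_of_mixedSum_ne_zero (L : List (α → ℝ)) (S : Finset α) (hS : M.Indep S)
    (h : M.mixedSum S L ≠ 0) : ∃ T : Finset α, M.Indep T ∧ #T = #S + L.length := by
  induction L generalizing S with
  | nil => exact ⟨S, hS, rfl⟩
  | cons v L ih =>
    rw [mixedSum_cons] at h
    obtain ⟨i, -, hi⟩ := exists_ne_zero_of_sum_ne_zero h
    obtain ⟨h1, h2⟩ := ne_zero_and_ne_zero_of_mul (right_ne_zero_of_mul hi)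
    obtain ⟨hiS, hind⟩ := M.extend_ne_zero_iff.1 h1
    obtain ⟨T, hT, hc⟩ := ih _ hind h2
    exact ⟨T, hT, by rw [hc, card_insert_of_notMem hiS, List.length_cons]; omega⟩

/-! ### Reverse Cauchy-Schwarz inequality -/

/-- A quadratic form which is nonpositive on the kernel of a linear functional satisfies the
reverse Cauchy-Schwarz inequality against nonnegative vectors. -/
theorem mixedSum_mul_le_sq_of_ker (S : Finset α) (V : List (α → ℝ)) (hV : ∀ v ∈ V, ∀ i, 0 ≤ v i)
    (l : (α → ℝ) →ₗ[ℝ] ℝ) (hl : ∀ z, l z = 0 → M.mixedSum S (z :: z :: V) ≤ 0)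
    (x y : α → ℝ) (hy : ∀ i, 0 ≤ y i) :
    M.mixedSum S (x :: x :: V) * M.mixedSum S (y :: y :: V) ≤ M.mixedSum S (x :: y :: V) ^ 2 := by
  have hyy : 0 ≤ M.mixedSum S (y :: y :: V) := M.mixedSum_nonneg _ (by
    intro v hv
    simp only [List.mem_cons] at hv
    rcases hv with rfl | rfl | hv
    exacts [hy, hy, hV v hv]) S
  rcases hyy.eq_or_lt with h0 | hpos
  · rw [← h0, mul_zero]; exact sq_nonneg _
  -- The form is positive at `y`, so `y` is not in the kernel and `x` can be projected into the
  -- kernel along `y`.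
  have hly : l y ≠ 0 := fun h => absurd (hl y h) hpos.not_ge
  obtain ⟨t, ht⟩ : ∃ t : ℝ, l (x - t • y) = 0 := ⟨l x / l y, by
    rw [map_sub, map_smul, smul_eq_mul]; field_simp; ring⟩
  have h := hl _ ht
  rw [mixedSum_sub_smul, M.mixedSum_swap S x, M.mixedSum_swap S y, mixedSum_sub_smul,
    mixedSum_sub_smul, M.mixedSum_swap S y x] at h
  nlinarith [sq_nonneg (M.mixedSum S (x :: y :: V) - t * M.mixedSum S (y :: y :: V)),
    mul_nonneg hpos.le (sub_nonneg.2 h)]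

/-- Two elements extending an independent set extend it together unless they are parallel. -/
theorem extend_insert_eq_ite (hE : M.E = Set.univ) (S : Finset α) (i j : α)
    (hi : M.extend S i ≠ 0) (hj : M.extend S j ≠ 0) [Decidable
      (M.closure (insert i S : Finset α) = M.closure (insert j S : Finset α))] :
    M.extend (insert i S) j = 1 -
      if M.closure (insert i S : Finset α) = M.closure (insert j S : Finset α) then 1 else 0 := by
  have key : ∀ i j, M.extend S i ≠ 0 → M.extend S j ≠ 0 → M.extend (insert i S) j = 0 →
      M.closure (insert j S : Finset α) ⊆ M.closure (insert i S : Finset α) := by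
    intro i j hi hj h
    obtain ⟨hiS, hi'⟩ := M.extend_ne_zero_iff.1 hi
    refine M.closure_subset_closure_of_subset_closure ?_
    have hsub : ((insert i S : Finset α) : Set α) ⊆ M.closure (insert i S : Finset α) :=
      M.subset_closure _ (by rw [hE]; exact Set.subset_univ _)
    rw [coe_insert j, Set.insert_subset_iff]
    refine ⟨?_, fun k hk => hsub (by simp [mem_coe.1 hk])⟩
    rw [hi'.mem_closure_iff']
    refine ⟨hE ▸ Set.mem_univ j, fun hind => ?_⟩
    by_contra hjS
    exact (M.extend_ne_zero_iff.2 ⟨by simpa using hjS, by rwa [coe_insert]⟩) h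
  split_ifs with hcl
  · rw [sub_self]
    by_contra hne
    obtain ⟨hjS, hind⟩ := M.extend_ne_zero_iff.1 hne
    obtain ⟨-, hi'⟩ := M.extend_ne_zero_iff.1 hi
    have : j ∈ M.closure (insert i S : Finset α) := by
      rw [hcl]
      exact M.subset_closure _ (by rw [hE]; exact Set.subset_univ _) (by simp)
    rw [hi'.mem_closure_iff'] at this
    exact hjS (by simpa using this.2 (by rwa [coe_insert] at hind))
  · rw [sub_zero]
    refine extend_eq_one M (M.extend_ne_zero_iff.1 fun h => hcl ?_)
    refine Set.Subset.antisymm (key j i hj hi ?_) (key i j hi hj h)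
    have := M.extend_mul_extend_comm S i j
    rw [h, mul_zero] at this
    exact (mul_eq_zero.1 this.symm).resolve_left hj

/-- The degree-two base case. Two extending elements fail to extend jointly exactly when parallel
over `S`, so the form is `(∑ w)²` minus the squares of the sums of `w` over parallel classes, and
the first square vanishes. -/
theorem mixedSum_pair_nonpos (hE : M.E = Set.univ) (S : Finset α) (z : α → ℝ)
    (hz : ∑ i, M.extend S i * z i = 0) : M.mixedSum S [z, z] ≤ 0 := by
  classical
  let cl : α → Set α := fun i => M.closure (insert i S : Finset α)
  let w : α → ℝ := fun i => M.extend S i * z i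
  have h1 : M.mixedSum S [z, z] =
      ∑ i, ∑ j, w i * w j - ∑ i, ∑ j, if cl i = cl j then w i * w j else 0 := by
    rw [mixedSum_cons_cons, ← sum_sub_distrib]
    refine sum_congr rfl fun i _ => ?_
    rw [← sum_sub_distrib, mul_sum]
    refine sum_congr rfl fun j _ => ?_
    rw [mixedSum_nil]
    simp only [w]
    by_cases hi : M.extend S i = 0
    · simp [hi]
    by_cases hj : M.extend S j = 0
    · rw [extend_mul_extend_comm]
      simp [hj]
    rw [M.extend_insert_eq_ite hE S i j hi hj, extend_eq_one M (M.extend_ne_zero_iff.1 hi),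
      extend_eq_one M (M.extend_ne_zero_iff.1 hj)]
    simp only [cl]
    split_ifs <;> ring
  have h2 : ∑ i, ∑ j, (if cl i = cl j then w i * w j else 0) =
      ∑ c : Set α, (∑ i, if cl i = c then w i else 0) ^ 2 := by
    have : ∀ c : Set α, (∑ i, if cl i = c then w i else 0) ^ 2 =
        ∑ i, ∑ j, if cl i = c then (if cl j = c then w i * w j else 0) else 0 := fun c => by
      rw [sq, sum_mul_sum]
      refine sum_congr rfl fun i _ => sum_congr rfl fun j _ => ?_
      split_ifs <;> simp
    simp only [this]
    symm
    rw [sum_comm]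
    refine sum_congr rfl fun i _ => ?_
    rw [sum_comm]
    refine sum_congr rfl fun j _ => ?_
    rw [sum_ite_eq, if_pos (mem_univ _)]
    simp only [eq_comm]
  rw [h1, h2, ← sum_mul_sum, hz]
  have : 0 ≤ ∑ c : Set α, (∑ i, if cl i = c then w i else 0) ^ 2 :=
    sum_nonneg fun c _ => sq_nonneg _
  linarith

/-- If all links satisfy the reverse Cauchy-Schwarz inequality, the Bochner argument applies. -/
theorem mixedSum_nonpos_of_links (S : Finset α) (hS : M.Indep S) (v : α → ℝ) (hv : ∀ i, 0 < v i)
    (W : List (α → ℝ)) (hW : ∀ w ∈ W, ∀ i, 0 < w i)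
    (ih : ∀ S' : Finset α, M.Indep S' → ∀ x : α → ℝ,
      M.mixedSum S' (x :: x :: W) * M.mixedSum S' (v :: v :: W) ≤
        M.mixedSum S' (x :: v :: W) ^ 2)
    (x : α → ℝ) (hx : M.mixedSum S (x :: v :: v :: W) = 0) :
    M.mixedSum S (x :: x :: v :: W) ≤ 0 := by
  have hvW : ∀ u ∈ v :: W, ∀ i, 0 < u i := by
    intro u hu
    rcases List.mem_cons.1 hu with rfl | hu
    exacts [hv, hW u hu]
  -- Without an independent set of this size the derivative is zero; otherwise `T` feeds every
  -- positivity and augmentation argument below.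
  by_cases hT : ∃ T : Finset α, M.Indep T ∧ #T = #S + (x :: x :: v :: W).length
  swap
  · by_contra hne
    exact hT (M.exists_indep_of_mixedSum_ne_zero _ S hS (fun h => hne h.le))
  obtain ⟨T, hT, hTc⟩ := hT
  simp only [List.length_cons] at hTc
  -- The second-derivative matrix, rescaled by `v` so that the all-ones vector corresponds to the
  -- direction `v`.
  let C : α → α → ℝ := fun i j => v i * v j *
    (M.extend S i * M.extend (insert i S) j * M.mixedSum (insert j (insert i S)) (v :: W))
  have hCz : ∀ (z : α → ℝ) i, ∑ j, C i j * z j =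
      v i * (M.extend S i * M.mixedSum (insert i S) (v :: (v * z) :: W)) := by
    intro z i
    rw [mixedSum_swap, mixedSum_cons, mul_sum, mul_sum]
    refine sum_congr rfl fun j _ => ?_
    simp only [C, Pi.mul_apply]
    ring
  have hform : ∀ z : α → ℝ, ∑ i, z i * ∑ j, C i j * z j =
      M.mixedSum S ((v * z) :: (v * z) :: v :: W) := by
    intro z
    rw [mixedSum_cons]
    refine sum_congr rfl fun i _ => ?_
    rw [hCz, mixedSum_swap]
    simp only [Pi.mul_apply]
    ring
  have hc : ∀ i, v i * (M.extend S i * M.mixedSum (insert i S) (v :: v :: W)) = ∑ j, C i j := by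
    intro i
    have := hCz 1 i
    simpa using this.symm
  have hpos : ∀ i, M.extend S i ≠ 0 → 0 < M.mixedSum (insert i S) (v :: v :: W) := by
    intro i hi
    obtain ⟨hiS, hind⟩ := M.extend_ne_zero_iff.1 hi
    refine M.mixedSum_pos _ ?_ _ T hind hT ?_
    · intro u hu
      rcases List.mem_cons.1 hu with rfl | hu
      exacts [hv, hvW u hu]
    · rw [card_insert_of_notMem hiS]
      simp only [List.length_cons]
      omega
  have hCadj : ∀ i j, M.extend S i ≠ 0 → M.extend (insert i S) j ≠ 0 → C i j ≠ 0 := by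
    intro i j hi hj
    obtain ⟨hiS, hind⟩ := M.extend_ne_zero_iff.1 hi
    obtain ⟨hjS, hjnd⟩ := M.extend_ne_zero_iff.1 hj
    have : 0 < M.mixedSum (insert j (insert i S)) (v :: W) := by
      refine M.mixedSum_pos _ hvW _ T hjnd hT ?_
      rw [card_insert_of_notMem hjS, card_insert_of_notMem hiS]
      simp only [List.length_cons]
      omega
    exact mul_ne_zero (mul_ne_zero (hv i).ne' (hv j).ne') (mul_ne_zero (mul_ne_zero hi hj) this.ne')
  have hCsymm : ∀ i j, C i j = C j i := by
    intro i j
    simp only [C]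
    rw [extend_mul_extend_comm, Finset.insert_comm i j]
    ring
  have hCnn : ∀ i j, 0 ≤ C i j := fun i j =>
    mul_nonneg (mul_nonneg (hv i).le (hv j).le) (mul_nonneg
      (mul_nonneg (M.extend_nonneg _ _) (M.extend_nonneg _ _))
      (M.mixedSum_nonneg _ (fun u hu i => (hvW u hu i).le) _))
  let z : α → ℝ := fun i => x i / v i
  have hvz : v * z = x := by
    funext i
    simp only [z, Pi.mul_apply]
    rw [mul_div_cancel₀ _ (hv i).ne']
  have hmain := form_nonpos_of_bochner C hCsymm hCnn
    (fun i => v i * (M.extend S i * M.mixedSum (insert i S) (v :: v :: W))) hc ?_ ?_ z ?_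
  · rwa [hform, hvz] at hmain
  · intro z hz i j hi hj
    have hi' : M.extend S i ≠ 0 := left_ne_zero_of_mul (right_ne_zero_of_mul hi)
    have hj' : M.extend S j ≠ 0 := left_ne_zero_of_mul (right_ne_zero_of_mul hj)
    -- Connectivity: non-adjacent `i`, `j` have a common neighbour. Choose `k` adjacent to `i`;
    -- augmenting `S + j` from `S + i + k` must add `k`, since adding `i` would make `i`, `j`
    -- adjacent.
    by_cases hij : M.extend (insert i S) j = 0
    swap
    · exact hz i j (hCadj i j hi' hij)
    obtain ⟨hiS, hind⟩ := M.extend_ne_zero_iff.1 hi'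
    obtain ⟨hjS, hjnd⟩ := M.extend_ne_zero_iff.1 hj'
    obtain ⟨k, -, hk, hknd⟩ := hind.augment_finset hT
      (by rw [card_insert_of_notMem hiS]; omega)
    rw [← coe_insert] at hknd
    have hik : M.extend (insert i S) k ≠ 0 := M.extend_ne_zero_iff.2 ⟨hk, hknd⟩
    obtain ⟨e, he, heS, hend⟩ := hjnd.augment_finset hknd
      (by rw [card_insert_of_notMem hk, card_insert_of_notMem hiS, card_insert_of_notMem hjS]
          omega)
    rw [← coe_insert] at hend
    have hje : M.extend (insert j S) e ≠ 0 := M.extend_ne_zero_iff.2 ⟨heS, hend⟩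
    have hek : e = k := by
      simp only [mem_insert, not_or] at he heS
      rcases he with rfl | rfl | he
      · rfl
      · have := M.extend_mul_extend_comm S e j
        rw [hij, mul_zero] at this
        exact absurd this.symm (mul_ne_zero hj' hje)
      · exact absurd he heS.2
    subst hek
    rw [hz i e (hCadj i e hi' hik), hz j e (hCadj j e hj' hje)]
  · intro z
    -- Expanding along `v` writes the form as a sum over links, where the inductive inequality
    -- bounds each term.
    have hperm : ((v * z) :: (v * z) :: v :: W).Perm (v :: (v * z) :: (v * z) :: W) :=
      ((List.Perm.swap v (v * z) W).cons (v * z)).trans (List.Perm.swap v (v * z) _)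
    rw [hform, M.mixedSum_perm hperm, mixedSum_cons]
    refine sum_le_sum fun i _ => ?_
    rw [hCz]
    by_cases hi : M.extend S i = 0
    · simp [hi]
    have hi1 := M.extend_ne_zero_iff.1 hi
    have h := ih (insert i S) hi1.2 (v * z)
    rw [mixedSum_swap _ _ (v * z) v] at h
    rw [extend_eq_one M hi1, one_mul, one_mul, one_mul,
      le_div_iff₀ (mul_pos (hv i) (hpos i hi))]
    nlinarith [mul_le_mul_of_nonneg_left h (sq_nonneg (v i))]
  · rw [← hx, mixedSum_cons]
    refine sum_congr rfl fun i _ => ?_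
    have := congrFun hvz i
    simp only [Pi.mul_apply] at this
    rw [← this]
    ring

/-- Reverse Cauchy-Schwarz inequality for mixed derivatives along positive vectors. -/
theorem mixedSum_mul_le_sq_of_pos (hE : M.E = Set.univ) (V : List (α → ℝ))
    (hV : ∀ v ∈ V, ∀ i, 0 < v i) (S : Finset α) (hS : M.Indep S) (x y : α → ℝ)
    (hy : ∀ i, 0 ≤ y i) :
    M.mixedSum S (x :: x :: V) * M.mixedSum S (y :: y :: V) ≤ M.mixedSum S (x :: y :: V) ^ 2 := by
  induction V generalizing S x y with
  | nil =>
    refine M.mixedSum_mul_le_sq_of_ker S [] (by simp)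
      (∑ i, M.extend S i • LinearMap.proj i) (fun z hz => ?_) x y hy
    refine M.mixedSum_pair_nonpos hE S z ?_
    simpa using hz
  | cons v W ih =>
    have hW : ∀ w ∈ W, ∀ i, 0 < w i := fun w hw => hV w (by simp [hw])
    have hv : ∀ i, 0 < v i := hV v (by simp)
    refine M.mixedSum_mul_le_sq_of_ker S (v :: W) (fun u hu i => (hV u hu i).le)
      (∑ i, (M.extend S i * M.mixedSum (insert i S) (v :: v :: W)) • LinearMap.proj i)
      (fun z hz => ?_) x y hy
    refine M.mixedSum_nonpos_of_links S hS v hv W hW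
      (fun S' hS' x => ih hW S' hS' x v fun i => (hv i).le) z ?_
    rw [← hz, mixedSum_cons]
    simp [mul_comm]

theorem continuous_mixedSum_map_add (L : List (α → ℝ)) (S : Finset α) :
    Continuous fun t : ℝ => M.mixedSum S (L.map fun v i => v i + t) := by
  induction L generalizing S with
  | nil => exact continuous_const
  | cons v L ih =>
    simp only [List.map_cons, mixedSum_cons]
    exact continuous_finsetSum _ fun i _ =>
      (continuous_const.add continuous_id).mul (continuous_const.mul (ih _))

/-- Reverse Cauchy-Schwarz inequality for mixed derivatives along nonnegative vectors. -/
theorem mixedSum_mul_le_sq (hE : M.E = Set.univ) (V : List (α → ℝ))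
    (hV : ∀ v ∈ V, ∀ i, 0 ≤ v i) (S : Finset α) (hS : M.Indep S) (x y : α → ℝ)
    (hy : ∀ i, 0 ≤ y i) :
    M.mixedSum S (x :: x :: V) * M.mixedSum S (y :: y :: V) ≤ M.mixedSum S (x :: y :: V) ^ 2 := by
  -- All vectors are shifted by `t > 0`, and the inequality passes to the limit `t → 0`.
  let P : List (α → ℝ) → ℝ → ℝ := fun L t => M.mixedSum S (L.map fun v i => v i + t)
  have hP : ∀ L, Continuous (P L) := fun L => M.continuous_mixedSum_map_add L S
  have hP0 : ∀ L, P L 0 = M.mixedSum S L := fun L => by simp [P]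
  have hcl : (0 : ℝ) ∈ _root_.closure (Set.Ioi (0 : ℝ)) := by
    rw [closure_Ioi]; exact Set.self_mem_Ici
  have h := le_on_closure (s := Set.Ioi (0 : ℝ))
    (f := fun t => P (x :: x :: V) t * P (y :: y :: V) t)
    (g := fun t => P (x :: y :: V) t ^ 2) (fun t ht => by
      refine M.mixedSum_mul_le_sq_of_pos hE _ ?_ S hS _ _
        (fun i => add_nonneg (hy i) (le_of_lt ht))
      intro v hv i
      obtain ⟨w, hw, rfl⟩ := List.mem_map.1 hv
      exact add_pos_of_nonneg_of_pos (hV w hw i) ht)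
    ((hP _).mul (hP _)).continuousOn ((hP _).pow 2).continuousOn hcl
  simpa only [hP0] using h

end Matroid

/-! ### Counting bases by their intersection with a set -/

namespace Matroid

section Counting

variable {α : Type*} [DecidableEq α] [Fintype α] (M : Matroid α)

open Classical in
/-- The independent sets containing `S`, with `a` further elements in `G` and `b` in `G'`. -/
noncomputable def indepFamily (S G : Finset α) (a : ℕ) (G' : Finset α) (b : ℕ) :
    Finset (Finset α) :=
  {T | M.Indep (T : Set α) ∧ S ⊆ T ∧ #((T \ S) ∩ G) = a ∧ #((T \ S) ∩ G') = b}

theorem mem_indepFamily {S G G' T : Finset α} {a b : ℕ} : T ∈ M.indepFamily S G a G' b ↔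
    M.Indep (T : Set α) ∧ S ⊆ T ∧ #((T \ S) ∩ G) = a ∧ #((T \ S) ∩ G') = b := by
  simp [indepFamily]

theorem indepFamily_swap (S G G' : Finset α) (a b : ℕ) :
    M.indepFamily S G a G' b = M.indepFamily S G' b G a := by
  ext T; simp only [mem_indepFamily]; tauto

theorem mem_indepFamily_insert {S G G' : Finset α} (hG : Disjoint G G') {a b : ℕ} {i : α}
    (hiG : i ∈ G) (hiS : i ∉ S) (T : Finset α) :
    T ∈ M.indepFamily (insert i S) G a G' b ↔
      T ∈ M.indepFamily S G (a + 1) G' b ∧ i ∈ (T \ S) ∩ G := by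
  have h1 : (T \ insert i S) ∩ G = ((T \ S) ∩ G).erase i := by
    ext j; simp only [mem_inter, mem_sdiff, mem_insert, mem_erase]; tauto
  have h2 : (T \ insert i S) ∩ G' = (T \ S) ∩ G' := by
    ext j
    simp only [mem_inter, mem_sdiff, mem_insert]
    have : j = i → j ∉ G' := fun h => h ▸ disjoint_left.1 hG hiG
    tauto
  simp only [mem_indepFamily, h1, h2, insert_subset_iff]
  constructor
  · rintro ⟨hT, ⟨hi, hS⟩, ha, hb⟩
    have hmem : i ∈ (T \ S) ∩ G := by simp [hi, hiS, hiG]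
    have := card_pos.2 ⟨i, hmem⟩
    rw [card_erase_of_mem hmem] at ha
    exact ⟨⟨hT, hS, by omega, hb⟩, hmem⟩
  · rintro ⟨⟨hT, hS, ha, hb⟩, hmem⟩
    refine ⟨hT, ⟨?_, hS⟩, by rw [card_erase_of_mem hmem, ha, Nat.add_sub_cancel], hb⟩
    simp only [mem_inter, mem_sdiff] at hmem
    exact hmem.1.1

/-- Double counting of pairs `(T, i)` with `i ∈ (T \ S) ∩ G`: each `T` has `a + 1` such `i`. -/
theorem sum_card_indepFamily_insert {G G' : Finset α} (hG : Disjoint G G') (S : Finset α)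
    (a b : ℕ) : ∑ i, (if i ∈ G then (1 : ℝ) else 0) *
      (M.extend S i * #(M.indepFamily (insert i S) G a G' b)) =
      (a + 1) * #(M.indepFamily S G (a + 1) G' b) := by
  have h1 : ∀ i, (if i ∈ G then (1 : ℝ) else 0) *
      (M.extend S i * #(M.indepFamily (insert i S) G a G' b)) =
      ∑ T ∈ M.indepFamily S G (a + 1) G' b, if i ∈ (T \ S) ∩ G then (1 : ℝ) else 0 := by
    intro i
    rw [← sum_filter, sum_const, nsmul_one]
    by_cases hi : i ∈ G ∧ i ∉ S
    · have heq : M.indepFamily (insert i S) G a G' b =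
          (M.indepFamily S G (a + 1) G' b).filter (fun T => i ∈ (T \ S) ∩ G) := by
        ext T
        rw [mem_filter, M.mem_indepFamily_insert hG hi.1 hi.2]
      rw [← heq, if_pos hi.1, one_mul]
      rcases (M.indepFamily (insert i S) G a G' b).eq_empty_or_nonempty with h | ⟨T, hT⟩
      · simp [h]
      · rw [mem_indepFamily] at hT
        rw [extend_eq_one M ⟨hi.2, hT.1.subset (by exact_mod_cast hT.2.1)⟩, one_mul]
    · have hempty : (M.indepFamily S G (a + 1) G' b).filter (fun T => i ∈ (T \ S) ∩ G) = ∅ := by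
        refine filter_eq_empty_iff.2 fun T _ h => hi ?_
        simp only [mem_inter, mem_sdiff] at h
        exact ⟨h.2, h.1.2⟩
      rw [hempty]
      by_cases hiG : i ∈ G
      · have : M.extend S i = 0 := by
          by_contra h
          exact hi ⟨hiG, (M.extend_ne_zero_iff.1 h).1⟩
        simp [this]
      · simp [hiG]
  simp only [h1]
  rw [sum_comm]
  have h2 : ∀ T ∈ M.indepFamily S G (a + 1) G' b,
      ∑ i, (if i ∈ (T \ S) ∩ G then (1 : ℝ) else 0) = a + 1 := by
    intro T hT
    rw [← sum_filter, sum_const, nsmul_one, filter_univ_mem, (M.mem_indepFamily.1 hT).2.2.1]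
    push_cast
    rfl
  rw [sum_congr rfl h2, sum_const, nsmul_eq_mul, mul_comm]

theorem mixedSum_indicator_cons (G S : Finset α) (L : List (α → ℝ)) (c : ℝ) (f : Finset α → ℝ)
    (h : ∀ S' : Finset α, M.Indep S' → M.mixedSum S' L = c * f S') :
    M.mixedSum S ((fun i => if i ∈ G then 1 else 0) :: L) =
      c * ∑ i, (if i ∈ G then (1 : ℝ) else 0) * (M.extend S i * f (insert i S)) := by
  rw [mixedSum_cons, mul_sum]
  refine sum_congr rfl fun i _ => ?_
  by_cases hi : M.extend S i = 0
  · simp [hi]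
  · rw [h _ (M.extend_ne_zero_iff.1 hi).2]
    ring

/-- Mixed derivatives along two complementary indicator vectors count independent sets. -/
theorem mixedSum_replicate (F : Finset α) (a b : ℕ) (S : Finset α) (hS : M.Indep S) :
    M.mixedSum S (List.replicate a (fun i => if i ∈ Fᶜ then 1 else 0) ++
      List.replicate b (fun i => if i ∈ F then 1 else 0)) =
      a.factorial * b.factorial * #(M.indepFamily S Fᶜ a F b) := by
  have hF : Disjoint Fᶜ F := disjoint_compl_left
  induction a generalizing S with
  | zero =>
    induction b generalizing S with
    | zero =>
      have : M.indepFamily S Fᶜ 0 F 0 = {S} := by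
        ext T
        rw [mem_indepFamily, mem_singleton]
        constructor
        · rintro ⟨-, hST, h1, h2⟩
          refine Subset.antisymm (fun i hi => ?_) hST
          by_contra hiS
          rw [card_eq_zero] at h1 h2
          by_cases hiF : i ∈ F
          · exact notMem_empty i (h2 ▸ by simp [hi, hiS, hiF])
          · exact notMem_empty i (h1 ▸ by simp [hi, hiS, hiF])
        · rintro rfl
          simp [hS]
      simp [this, mixedSum_nil]
    | succ b ih =>
      rw [List.replicate_zero, List.nil_append] at ih ⊢
      rw [List.replicate_succ, M.mixedSum_indicator_cons F S _ _ _ ih]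
      simp only [M.indepFamily_swap _ Fᶜ F]
      rw [M.sum_card_indepFamily_insert hF.symm, Nat.factorial_succ]
      push_cast
      ring
  | succ a ih =>
    rw [List.replicate_succ, List.cons_append, M.mixedSum_indicator_cons Fᶜ S _ _ _ ih,
      M.sum_card_indepFamily_insert hF, Nat.factorial_succ]
    push_cast
    ring

/-- The number of bases meeting `F` in `k` elements. -/
noncomputable def numBases (F : Finset α) (k : ℕ) : ℕ :=
  {B : Finset α | M.IsBase (B : Set α) ∧ #(B ∩ F) = k}.ncard

theorem numBases_eq_card_indepFamily (F : Finset α) (a b : ℕ)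
    (hr : ∀ B : Finset α, M.IsBase (B : Set α) → #B = a + b) :
    M.numBases F b = #(M.indepFamily ∅ Fᶜ a F b) := by
  rw [numBases, ← Set.ncard_coe_finset]
  congr 1
  ext B
  have hB : #(B ∩ Fᶜ) + #(B ∩ F) = #B := by
    rw [← card_inter_add_card_sdiff B F, add_comm, sdiff_eq_inter_compl]
  simp only [Set.mem_ofPred_eq, mem_coe, mem_indepFamily, empty_subset, sdiff_empty, true_and]
  constructor
  · rintro ⟨h, hb⟩
    have := hr B h
    exact ⟨h.indep, by omega, hb⟩
  · rintro ⟨h, ha, hb⟩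
    refine ⟨?_, hb⟩
    obtain ⟨B', hB', hBB'⟩ := h.exists_isBase_superset
    obtain ⟨B', rfl⟩ := B'.toFinite.exists_finset_coe
    have := hr B' hB'
    rwa [eq_of_subset_of_card_le (coe_subset.1 hBB') (by omega)]

/-- Exchanging elements from one base to another changes the intersection with `F` by steps of at
most one. -/
theorem exists_isBase_card_inter_eq (F : Finset α) (k : ℕ) (B' : Finset α)
    (hB' : M.IsBase (B' : Set α)) (hk' : k ≤ #(B' ∩ F)) (d : ℕ) :
    ∀ B : Finset α, M.IsBase (B : Set α) → #(B ∩ F) ≤ k → #(B \ B') = d →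
      ∃ B₀ : Finset α, M.IsBase (B₀ : Set α) ∧ #(B₀ ∩ F) = k := by
  induction d with
  | zero =>
    intro B hB hk hd
    have hsub : B ⊆ B' := by rwa [card_eq_zero, sdiff_eq_empty_iff_subset] at hd
    have : B = B' := by exact_mod_cast hB.eq_of_subset_isBase hB' (by exact_mod_cast hsub)
    exact ⟨B, hB, by rw [this] at hk ⊢; omega⟩
  | succ d ih =>
    intro B hB hk hd
    rcases hk.eq_or_lt with hk | hk
    · exact ⟨B, hB, hk⟩
    obtain ⟨e, he⟩ := card_pos.1 (by omega : 0 < #(B \ B'))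
    obtain ⟨f, hf, hbase⟩ := hB.exchange hB' (e := e) (by simpa using he)
    rw [← coe_sdiff, mem_coe] at hf
    rw [mem_sdiff] at he hf
    have hco : (insert f ((B : Set α) \ {e})) = (insert f (B.erase e) : Finset α) := by
      rw [coe_insert, coe_erase]
    rw [hco] at hbase
    refine ih _ hbase ?_ ?_
    · calc #(insert f (B.erase e) ∩ F) ≤ #(insert f (B ∩ F)) := card_le_card fun j => by
            simp only [mem_inter, mem_insert, mem_erase]; tauto
        _ ≤ #(B ∩ F) + 1 := card_insert_le _ _
        _ ≤ k := hk
    · have : insert f (B.erase e) \ B' = (B \ B').erase e := by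
        ext j
        simp only [mem_sdiff, mem_insert, mem_erase]
        have : j = f → j ∈ B' := fun h => h ▸ hf.1
        tauto
      rw [this, card_erase_of_mem (mem_sdiff.2 he), hd, Nat.add_sub_cancel]

theorem numBases_ne_zero_iff (F : Finset α) (k : ℕ) :
    M.numBases F k ≠ 0 ↔ ∃ B : Finset α, M.IsBase (B : Set α) ∧ #(B ∩ F) = k := by
  rw [numBases, ← Nat.pos_iff_ne_zero, Set.ncard_pos]
  rfl

/-- The numbers of bases of a matroid of rank `r` by the size of their intersection with a fixed
set form an ultra log-concave sequence. -/
theorem isUltraLogConcaveSeq_numBases (hE : M.E = Set.univ) (F : Finset α) (r : ℕ)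
    (hr : ∀ B : Finset α, M.IsBase (B : Set α) → #B = r) :
    IsUltraLogConcaveSeq r (fun k => (M.numBases F k : ℝ)) := by
  have hch : ∀ k ≤ r, (r.choose k : ℝ) ≠ 0 := fun k hk =>
    Nat.cast_ne_zero.2 (Nat.choose_pos hk).ne'
  refine ⟨fun k _ => by positivity, fun i j k hik hkj hjr hi hj => ?_, fun k hk1 hkr => ?_⟩
  · have hi' : M.numBases F i ≠ 0 := fun h => hi (by simp [h])
    have hj' : M.numBases F j ≠ 0 := fun h => hj (by simp [h])
    obtain ⟨B, hB, hBi⟩ := (M.numBases_ne_zero_iff F i).1 hi'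
    obtain ⟨B', hB', hBj⟩ := (M.numBases_ne_zero_iff F j).1 hj'
    refine div_ne_zero (Nat.cast_ne_zero.2 ((M.numBases_ne_zero_iff F k).2 ?_))
      (hch k (by omega))
    exact M.exists_isBase_card_inter_eq F k B' hB' (by omega) _ B hB (by omega) rfl
  · obtain ⟨b, rfl⟩ : ∃ b, k = b + 1 := ⟨k - 1, by omega⟩
    obtain ⟨a, rfl⟩ : ∃ a, r = a + b + 2 := ⟨r - b - 2, by omega⟩
    let u : α → ℝ := fun i => if i ∈ Fᶜ then 1 else 0
    let w : α → ℝ := fun i => if i ∈ F then 1 else 0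
    have hu : ∀ i, 0 ≤ u i := fun i => by simp only [u]; split_ifs <;> norm_num
    have hw : ∀ i, 0 ≤ w i := fun i => by simp only [w]; split_ifs <;> norm_num
    -- Since `a'! b'! / (a' + b')!` is the inverse binomial coefficient, the normalized counts are
    -- mixed derivatives over a common factor `r!`.
    have hval : ∀ a' b', a' + b' = a + b + 2 →
        M.mixedSum ∅ (List.replicate a' u ++ List.replicate b' w) / ((a + b + 2).factorial : ℝ) =
          M.numBases F b' / ((a + b + 2).choose b' : ℝ) := by
      intro a' b' h
      rw [M.mixedSum_replicate F a' b' ∅ (by simp),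
        ← M.numBases_eq_card_indepFamily F a' b' (by rw [h]; exact hr),
        Nat.cast_choose ℝ (by omega : b' ≤ a + b + 2), ← h, Nat.add_sub_cancel]
      have := Nat.factorial_ne_zero (a' + b')
      have := Nat.factorial_ne_zero a'
      have := Nat.factorial_ne_zero b'
      field_simp
    have h := M.mixedSum_mul_le_sq hE (List.replicate a u ++ List.replicate b w) (by
      intro v hv
      rcases List.mem_append.1 hv with hv | hv
      · rw [List.eq_of_mem_replicate hv]; exact hu
      · rw [List.eq_of_mem_replicate hv]; exact hw) ∅ (by simp) u w hw
    have e1 : u :: u :: (List.replicate a u ++ List.replicate b w) =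
        List.replicate (a + 2) u ++ List.replicate b w := rfl
    have e2 : M.mixedSum ∅ (u :: w :: (List.replicate a u ++ List.replicate b w)) =
        M.mixedSum ∅ (List.replicate (a + 1) u ++ List.replicate (b + 1) w) :=
      M.mixedSum_perm ((List.perm_middle.symm).cons u) ∅
    have e3 : M.mixedSum ∅ (w :: w :: (List.replicate a u ++ List.replicate b w)) =
        M.mixedSum ∅ (List.replicate a u ++ List.replicate (b + 2) w) :=
      M.mixedSum_perm ((List.perm_middle.symm.cons w).trans List.perm_middle.symm) ∅
    rw [e1, e2, e3] at h
    simp only [Nat.add_sub_cancel]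
    rw [← hval a (b + 1 + 1) (by omega), ← hval (a + 2) b (by omega),
      ← hval (a + 1) (b + 1) (by omega), div_mul_div_comm, div_pow, ← sq, mul_comm]
    exact div_le_div_of_nonneg_right h (sq_nonneg _)

end Counting

end Matroid

/-! ### The matroid of a bimatroid -/

namespace Bimatroid

variable {E F : Type*} [Fintype E] [DecidableEq E] [Fintype F] [DecidableEq F]

/-- The set `(E \ I) ∪ J` associated with the minor `(I, J)`. -/
def baseOfMinor (p : Finset E × Finset F) : Finset (E ⊕ F) := p.1ᶜ.disjSum p.2

theorem baseOfMinor_injective : Function.Injective (baseOfMinor (E := E) (F := F)) := by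
  rintro ⟨I, J⟩ ⟨I', J'⟩ h
  have h1 : ∀ x, x ∈ Iᶜ.disjSum J ↔ x ∈ I'ᶜ.disjSum J' := fun x => by
    rw [show Iᶜ.disjSum J = I'ᶜ.disjSum J' from h]
  refine Prod.ext ?_ ?_
  · ext i
    have := h1 (Sum.inl i)
    simp only [inl_mem_disjSum, mem_compl] at this
    exact not_iff_not.1 this
  · ext j
    have := h1 (Sum.inr j)
    simpa only [inr_mem_disjSum] using this

/-- The matroid on `E ⊕ F` with bases `(E \ I) ∪ J` for the regular minors `(I, J)`. -/
def toMatroid (A : Bimatroid E F) : Matroid (E ⊕ F) :=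
  Matroid.ofIsBaseOfFinite (E := Set.univ) Set.finite_univ
    (fun B => ∃ p ∈ A.regularMinors, B = baseOfMinor p)
    ⟨_, _, A.empty_mem, rfl⟩
    (by
      -- Deleting a row element from a base adds it to `I`, deleting a column element removes it
      -- from `J`. The two alternatives in each bimatroid axiom say whether the replacement lies in
      -- `E` or `F`.
      rintro _ _ ⟨⟨I, J⟩, hp, rfl⟩ ⟨⟨I', J'⟩, hp', rfl⟩ (e | e) he
      · simp only [baseOfMinor, Set.mem_sdiff, mem_coe, inl_mem_disjSum, mem_compl,
          not_not] at he
        rcases A.exchange_row I J I' J' hp hp' e (mem_sdiff.2 he.symm) with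
          ⟨i, hi, h⟩ | ⟨j, hj, h⟩
        · rw [mem_sdiff] at hi
          refine ⟨Sum.inl i, by simpa [baseOfMinor] using hi.symm, _, h, ?_⟩
          ext (x | x) <;> simp [baseOfMinor]
          have : x = i → x ≠ e := by rintro rfl rfl; exact he.1 hi.1
          tauto
        · rw [mem_sdiff] at hj
          refine ⟨Sum.inr j, by simpa [baseOfMinor] using hj, _, h, ?_⟩
          ext (x | x) <;> simp [baseOfMinor]
          tauto
      · simp only [baseOfMinor, Set.mem_sdiff, mem_coe, inr_mem_disjSum] at he
        rcases A.exchange_col I J I' J' hp hp' e (mem_sdiff.2 he) with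
          ⟨j, hj, h⟩ | ⟨i, hi, h⟩
        · rw [mem_sdiff] at hj
          refine ⟨Sum.inr j, by simpa [baseOfMinor] using hj, _, h, ?_⟩
          ext (x | x) <;> simp [baseOfMinor]
          tauto
        · rw [mem_sdiff] at hi
          refine ⟨Sum.inl i, by simpa [baseOfMinor] using hi.symm, _, h, ?_⟩
          ext (x | x) <;> simp [baseOfMinor]
          tauto)
    (fun _ _ => Set.subset_univ _)

theorem toMatroid_isBase_iff (A : Bimatroid E F) (B : Finset (E ⊕ F)) :
    A.toMatroid.IsBase (B : Set (E ⊕ F)) ↔ ∃ p ∈ A.regularMinors, B = baseOfMinor p := by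
  change (∃ p ∈ A.regularMinors, (B : Set (E ⊕ F)) = baseOfMinor p) ↔ _
  simp only [coe_inj]

theorem numBases_toMatroid (A : Bimatroid E F) (k : ℕ) :
    A.toMatroid.numBases (univ.map Function.Embedding.inr) k = A.numRegularMinors k := by
  rw [Matroid.numBases, numRegularMinors, ← Set.ncard_image_of_injective _ baseOfMinor_injective]
  congr 1
  have hcard : ∀ p : Finset E × Finset F,
      #(baseOfMinor p ∩ univ.map Function.Embedding.inr) = #p.2 := fun p => by
    rw [← card_map (Function.Embedding.inr : F ↪ E ⊕ F)]
    congr 1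
    ext (x | x) <;> simp [baseOfMinor]
  ext B
  simp only [Set.mem_ofPred_eq, Set.mem_image, toMatroid_isBase_iff]
  constructor
  · rintro ⟨⟨p, hp, rfl⟩, hk⟩
    exact ⟨p, ⟨hp, by rw [A.card_eq p.1 p.2 hp, ← hcard, hk]⟩, rfl⟩
  · rintro ⟨p, ⟨hp, hk⟩, rfl⟩
    exact ⟨⟨p, hp, rfl⟩, by rw [hcard, ← A.card_eq p.1 p.2 hp, hk]⟩

theorem numBases_dual_toMatroid (A : Bimatroid E F) (k : ℕ) :
    A.toMatroid✶.numBases (univ.map Function.Embedding.inl) k = A.numRegularMinors k := by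
  rw [Matroid.numBases, numRegularMinors, ← Set.ncard_image_of_injective _
    (compl_injective.comp baseOfMinor_injective)]
  congr 1
  have hcard : ∀ p : Finset E × Finset F,
      #((baseOfMinor p)ᶜ ∩ univ.map Function.Embedding.inl) = #p.1 := fun p => by
    rw [← card_map (Function.Embedding.inl : E ↪ E ⊕ F)]
    congr 1
    ext (x | x) <;> simp [baseOfMinor]
  have hdual : ∀ B : Finset (E ⊕ F), A.toMatroid✶.IsBase (B : Set (E ⊕ F)) ↔
      ∃ p ∈ A.regularMinors, B = (baseOfMinor p)ᶜ := fun B => by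
    rw [Matroid.dual_isBase_iff (Set.subset_univ _)]
    change A.toMatroid.IsBase (Set.univ \ _) ↔ _
    rw [← Set.compl_eq_univ_sdiff, ← coe_compl, toMatroid_isBase_iff]
    exact exists_congr fun p => and_congr_right fun _ =>
      ⟨fun h => by rw [← h, compl_compl], fun h => by rw [h, compl_compl]⟩
  ext B
  simp only [Set.mem_ofPred_eq, Set.mem_image, hdual, Function.comp_apply]
  constructor
  · rintro ⟨⟨p, hp, rfl⟩, hk⟩
    exact ⟨p, ⟨hp, by rw [← hcard, hk]⟩, rfl⟩
  · rintro ⟨p, ⟨hp, hk⟩, rfl⟩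
    exact ⟨⟨p, hp, rfl⟩, by rw [hcard, hk]⟩

theorem card_baseOfMinor (A : Bimatroid E F) (p : Finset E × Finset F)
    (hp : p ∈ A.regularMinors) : #(baseOfMinor p) = Fintype.card E := by
  rw [baseOfMinor, card_disjSum, card_compl, ← A.card_eq p.1 p.2 hp]
  have := card_le_univ p.1
  omega

theorem isUltraLogConcaveSeq_numRegularMinors (A : Bimatroid E F) :
    IsUltraLogConcaveSeq (min (Fintype.card E) (Fintype.card F))
      (fun k => (A.numRegularMinors k : ℝ)) := by
  -- The order of ultra log-concavity is the rank, so the smaller of `m` (matroid) and `n` (dual) is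
  -- chosen.
  rcases le_total (Fintype.card E) (Fintype.card F) with h | h
  · rw [min_eq_left h]
    simp only [← numBases_toMatroid]
    refine A.toMatroid.isUltraLogConcaveSeq_numBases rfl _ _ fun B hB => ?_
    obtain ⟨p, hp, rfl⟩ := (A.toMatroid_isBase_iff B).1 hB
    exact A.card_baseOfMinor p hp
  · rw [min_eq_right h]
    simp only [← numBases_dual_toMatroid]
    refine A.toMatroid✶.isUltraLogConcaveSeq_numBases rfl _ _ fun B hB => ?_
    have h1 := hB.compl_isBase_of_dual
    change A.toMatroid.IsBase (Set.univ \ _) at h1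
    rw [← Set.compl_eq_univ_sdiff, ← coe_compl, toMatroid_isBase_iff] at h1
    obtain ⟨p, hp, h2⟩ := h1
    have h3 := A.card_baseOfMinor p hp
    rw [← h2, card_compl, Fintype.card_sum] at h3
    have := card_le_univ B
    rw [Fintype.card_sum] at this
    omega

end Bimatroid

end

theorem mainTheorem1 {E F : Type*} [Fintype E] [DecidableEq E] [Fintype F] [DecidableEq F]
    (A : Bimatroid E F) (m n : ℕ) (hm : m = Fintype.card E) (hn : n = Fintype.card F) :
    IsUltraLogConcaveSeq (min m n) (fun k => (A.numRegularMinors k : ℝ)) ∧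
    ∀ k : ℕ, 1 ≤ k →
      (A.numRegularMinors k : ℝ) ^ 2 / ((min m n).choose k : ℝ) ^ 2 ≥
        (A.numRegularMinors (k + 1) : ℝ) / ((min m n).choose (k + 1) : ℝ) *
          ((A.numRegularMinors (k - 1) : ℝ) / ((min m n).choose (k - 1) : ℝ)) := by
  subst hm hn
  refine ⟨A.isUltraLogConcaveSeq_numRegularMinors, fun k hk => ?_⟩
  rcases lt_or_ge k (min (Fintype.card E) (Fintype.card F)) with h | h
  · rw [← div_pow]
    exact A.isUltraLogConcaveSeq_numRegularMinors.2.2 k hk h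
  -- Here `k + 1` exceeds `min m n`, and division by the zero binomial gives `0` on the right.
  · rw [Nat.choose_eq_zero_of_lt (Nat.lt_succ_of_le h), Nat.cast_zero, div_zero, zero_mul]
    positivity
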